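/- Let $D\subset\mathbb{C}$ be a simply connected hyperbolic region, that is, an open, simply connected set whose complement $\mathbb{C}\setminus D$ contains at least two points, and let $\lambda_D$ be its hyperbolic density of curvature $-4$, determined by $$\lambda_D(p(\zeta))\,|p'(\zeta)|=\frac{1}{1-|\zeta|^2},\qquad |\zeta|<1,$$ for one (equivalently, every) analytic covering map $p$ of the open unit disk onto $D$. If $f$ is conformal (analytic and univalent) in $D$, then there exists an analytic function $g$ in $D$ that is a branch of $\log f'$, that is, $e^{g(z)}=f'(z)$ for all $z\in D$, and hence $g'(z)=f''(z)/f'(z)$, such that $$|g'(z)|=\left|\frac{f''(z)}{f'(z)}\right|\le 8\,\lambda_D(z)\qquad\text{for all } z\in D.$$ -/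

import Mathlib

open Set Metric

/-- A hyperbolic region: an open connected subset of the plane whose complement contains at least
two points. -/
def IsHyperbolicRegion (D : Set ℂ) : Prop :=
  IsOpen D ∧ IsConnected D ∧ Dᶜ.Nontrivial

/-- `f` is a conformal mapping in `D`: analytic and univalent. For the open sets `D` considered here,
complex differentiability on `D` is analyticity. -/
def IsConformalMapping (f : ℂ → ℂ) (D : Set ℂ) : Prop :=
  DifferentiableOn ℂ f D ∧ InjOn f D

/-- `p` restricts to an analytic covering map of the open unit disk onto `D`. Since the disk is simply
connected this is a universal covering; being a local homeomorphism, it is locally univalent. -/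
def IsAnalyticDiskCovering (p : ℂ → ℂ) (D : Set ℂ) : Prop :=
  DifferentiableOn ℂ p (ball 0 1) ∧ p '' ball 0 1 = D ∧
    IsCoveringMapOn ((ball (0 : ℂ) 1).domRestrict p) D

/-- `r` is a solution of `r * |p'(z)| = 1 / (1 - |z|²)` for some analytic covering map `p` of the unit
disk onto `D` and some point `z` of the disk with `p z = w`. -/
def IsHyperbolicDensityAt (D : Set ℂ) (w : ℂ) (r : ℝ) : Prop :=
  ∃ p : ℂ → ℂ, IsAnalyticDiskCovering p D ∧
    ∃ z ∈ ball (0 : ℂ) 1, p z = w ∧ r * ‖deriv p z‖ = 1 / (1 - ‖z‖ ^ 2)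

open Classical in
/-- The hyperbolic (Poincaré) density `λ_D(w)` of curvature `-4`. On a hyperbolic region and for
`w ∈ D` there is exactly one `r` with `IsHyperbolicDensityAt D w r` (the value does not depend on the
covering map or on the preimage of `w`), and `λ_D(w)` is this `r`. It is set to `0` if there is no
such `r`. -/
noncomputable def hyperbolicDensity (D : Set ℂ) (w : ℂ) : ℝ :=
  if h : ∃ r : ℝ, IsHyperbolicDensityAt D w r then h.choose else 0

/-! Let `P` map the disk univalently onto `D` with `P 0 = z`, so that the density at `z` is `1 / ‖P'
0‖`. Bieberbach's inequality `‖h'' 0‖ ≤ 4 ‖h' 0‖` holds for `h = P` and for `h = f ∘ P`. Since `(f ∘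
P)'' = f'' P'^2 + f' P''`, the triangle inequality gives `‖f''‖ ‖P'‖^2 ≤ (4 + 4) ‖f'‖ ‖P'‖`, which
is the bound with constant 8. The function `g` is a logarithm of the zero-free `f'` on a simply
connected set.

Bieberbach's inequality (`norm_deriv_deriv_zero_le`) comes from the area theorem
(`norm_le_one_of_injOn_inv_add`) through the square-root transform. The area theorem avoids Green's
formula: the image of an annulus `ρ < ‖z‖ < r` is trapped in an ellipse by a connectedness argument,
its area is bounded below in polar coordinates, and then `ρ → 0`, `r → 1`.

The density is defined by covering maps. Their existence is the Riemann mapping theorem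
(`exists_surjOn_univalentDiskMaps`), proved by maximising a derivative; their univalence over a
simply connected set follows from uniqueness of lifts. -/

/-! ### Univalent functions: open images, analytic inverse, nonvanishing derivative. -/

open Filter Topology in
theorem not_eventually_const_of_injOn {f : ℂ → ℂ} {U : Set ℂ} {z : ℂ} (hU : U ∈ 𝓝 z)
    (hf : InjOn f U) : ¬ ∀ᶠ w in 𝓝 z, f w = f z := by
  intro h
  have h1 : ∀ᶠ w in 𝓝[≠] z, w ∈ U ∧ f w = f z ∧ w ≠ z := by
    filter_upwards [nhdsWithin_le_nhds hU, nhdsWithin_le_nhds h, self_mem_nhdsWithin] with w a b c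
    exact ⟨a, b, c⟩
  obtain ⟨w, hw, hfw, hne⟩ := h1.exists
  exact hne (hf hw (mem_of_mem_nhds hU) hfw)

open Filter Topology in
theorem isOpen_image_of_injOn {f : ℂ → ℂ} {U s : Set ℂ} (hU : IsOpen U)
    (hd : DifferentiableOn ℂ f U) (hf : InjOn f U) (hs : IsOpen s) (hsU : s ⊆ U) :
    IsOpen (f '' s) := by
  rw [isOpen_iff_mem_nhds]
  rintro _ ⟨w, hw, rfl⟩
  exact (hd.analyticAt (hU.mem_nhds (hsU hw))).eventually_constant_or_nhds_le_map_nhds.resolve_left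
    (not_eventually_const_of_injOn (hU.mem_nhds (hsU hw)) hf) (image_mem_map (hs.mem_nhds hw))

open Filter Topology in
/-- A univalent function has an analytic inverse, and its derivative has no zeros. -/
theorem exists_differentiableOn_leftInvOn {f : ℂ → ℂ} {U : Set ℂ} (hU : IsOpen U)
    (hd : DifferentiableOn ℂ f U) (hf : InjOn f U) :
    ∃ g : ℂ → ℂ, DifferentiableOn ℂ g (f '' U) ∧ LeftInvOn g f U := by
  set g := Function.invFunOn f U
  have hg : LeftInvOn g f U := hf.leftInvOn_invFunOn
  have hopen : IsOpen (f '' U) := isOpen_image_of_injOn hU hd hf hU Subset.rfl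
  have hcont : ∀ z ∈ U, ContinuousAt g (f z) := by
    intro z hz
    rw [ContinuousAt, hg hz]
    intro N hN
    obtain ⟨s, hsN, hs, hzs⟩ := _root_.mem_nhds_iff.1 (inter_mem hN (hU.mem_nhds hz))
    have hsU : s ⊆ U := fun x hx => (hsN hx).2
    refine mem_map.2 (mem_of_superset
      ((isOpen_image_of_injOn hU hd hf hs hsU).mem_nhds (mem_image_of_mem f hzs)) ?_)
    rintro _ ⟨x, hx, rfl⟩
    rw [mem_preimage, hg (hsU hx)]
    exact (hsN hx).1
  have hda : ∀ z ∈ U, deriv f z ≠ 0 → DifferentiableAt ℂ g (f z) := by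
    intro z hz hz'
    refine HasDerivAt.differentiableAt (HasDerivAt.of_local_left_inverse (hcont z hz)
      (f := f) (f' := deriv f z) ?_ hz' ?_)
    · rw [hg hz]
      exact (hd.differentiableAt (hU.mem_nhds hz)).hasDerivAt
    · filter_upwards [hopen.mem_nhds (mem_image_of_mem f hz)]
      rintro _ ⟨x, hx, rfl⟩
      rw [hg hx]
  refine ⟨g, ?_, hg⟩
  rintro _ ⟨z, hz, rfl⟩
  apply DifferentiableAt.differentiableWithinAt
  have han : AnalyticAt ℂ (deriv f) z := (hd.analyticAt (hU.mem_nhds hz)).deriv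
  rcases han.eventually_eq_zero_or_eventually_ne_zero with h | h
  · exfalso
    obtain ⟨ε, hε, hball⟩ := Metric.mem_nhds_iff.1 (inter_mem h (hU.mem_nhds hz))
    refine not_eventually_const_of_injOn (hU.mem_nhds hz) hf ?_
    filter_upwards [ball_mem_nhds z hε] with w hw
    exact (convex_ball z ε).is_const_of_fderivWithin_eq_zero (𝕜 := ℂ)
      (hd.mono fun x hx => (hball hx).2) (fun x hx => by
        rw [fderivWithin_of_isOpen isOpen_ball hx]
        ext
        simpa using (hball hx).1) hw (mem_ball_self hε)
  · rw [eventually_nhdsWithin_iff] at h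
    obtain ⟨s, hsN, hs, hzs⟩ := _root_.mem_nhds_iff.1 (inter_mem h (hU.mem_nhds hz))
    have hsU : s ⊆ U := fun x hx => (hsN hx).2
    have hm : f '' s ∈ 𝓝 (f z) :=
      (isOpen_image_of_injOn hU hd hf hs hsU).mem_nhds (mem_image_of_mem f hzs)
    -- Zeros of `f'` are isolated, so the continuous inverse is differentiable near `f z` off that
    -- point, and the singularity is removable.
    refine ((Complex.differentiableOn_compl_singleton_and_continuousAt_iff hm).1
      ⟨?_, hcont z hz⟩).differentiableAt hm
    rintro _ ⟨⟨x, hx, rfl⟩, hne⟩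
    refine (hda x (hsU hx) ((hsN hx).1 ?_)).differentiableWithinAt
    rintro rfl
    exact hne rfl

open Filter Topology in
theorem deriv_ne_zero_of_injOn {f : ℂ → ℂ} {U : Set ℂ} (hU : IsOpen U)
    (hd : DifferentiableOn ℂ f U) (hf : InjOn f U) {z : ℂ} (hz : z ∈ U) : deriv f z ≠ 0 := by
  obtain ⟨g, hgd, hg⟩ := exists_differentiableOn_leftInvOn hU hd hf
  have h1 := (hgd.differentiableAt ((isOpen_image_of_injOn hU hd hf hU Subset.rfl).mem_nhds
    (mem_image_of_mem f hz))).hasDerivAt.comp z (hd.differentiableAt (hU.mem_nhds hz)).hasDerivAt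
  have h2 : HasDerivAt (g ∘ f) 1 z := (hasDerivAt_id z).congr_of_eventuallyEq (by
    filter_upwards [hU.mem_nhds hz] with w hw using hg hw)
  intro h
  rw [h, mul_zero] at h1
  exact zero_ne_one (h1.unique h2)

/-! ### Analytic logarithms. -/

-- Near `z` a continuous logarithm varies by less than `π`, so it equals a constant plus the
-- principal logarithm of `F w / F z`, a quotient near 1 and away from the cut.
open Filter Topology in
theorem differentiableAt_of_exp_comp {g F : ℂ → ℂ} {z : ℂ} (hg : ContinuousAt g z)
    (hF : DifferentiableAt ℂ F z) (h : ∀ᶠ w in 𝓝 z, Complex.exp (g w) = F w) :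
    DifferentiableAt ℂ g z := by
  have h0 : Complex.exp (g z) = F z := h.self_of_nhds
  have hF0 : F z ≠ 0 := h0 ▸ Complex.exp_ne_zero _
  have hlim : Tendsto (fun w => g w - g z) (𝓝 z) (𝓝 0) := by
    simpa using hg.tendsto.sub_const (g z)
  have hsmall : ∀ᶠ w in 𝓝 z, ‖g w - g z‖ < Real.pi := by
    have := hlim.norm.eventually_lt_const (u := Real.pi) (by simpa using Real.pi_pos)
    exact this
  have heq : g =ᶠ[𝓝 z] fun w => g z + Complex.log (F w / F z) := by
    filter_upwards [h, hsmall] with w hw hs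
    have him := abs_lt.1 ((Complex.abs_im_le_norm _).trans_lt hs)
    rw [← hw, ← h0, ← Complex.exp_sub, Complex.log_exp him.1 him.2.le]
    ring
  refine DifferentiableAt.congr_of_eventuallyEq ?_ heq
  refine (DifferentiableAt.clog (hF.div_const _) ?_).const_add _
  simp [hF0]

theorem exists_differentiableOn_exp_eq {U : Set ℂ} (hU : IsOpen U) (hsc : IsSimplyConnected U)
    {F : ℂ → ℂ} (hF : DifferentiableOn ℂ F U) (h0 : ∀ z ∈ U, F z ≠ 0) :
    ∃ g : ℂ → ℂ, DifferentiableOn ℂ g U ∧ ∀ z ∈ U, Complex.exp (g z) = F z := by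
  obtain ⟨g, hgc, hg⟩ := Complex.exists_continuousOn_eqOn_exp_comp hsc hU hF.continuousOn
    (by rintro ⟨z, hz, h⟩; exact h0 z hz h)
  refine ⟨g, fun z hz => ?_, hg⟩
  refine (differentiableAt_of_exp_comp (hgc.continuousAt (hU.mem_nhds hz))
    (hF.differentiableAt (hU.mem_nhds hz)) ?_).differentiableWithinAt
  filter_upwards [hU.mem_nhds hz] with w hw using hg hw

theorem isSimplyConnected_ball (c : ℂ) {r : ℝ} (hr : 0 < r) : IsSimplyConnected (ball c r) := by
  have := (convex_ball c r).contractibleSpace (nonempty_ball.2 hr)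
  exact SimplyConnectedSpace.ofContractible _

/-! ### The area theorem. -/

-- On `‖z‖ = t` one has `conj z = t^2 / z`, so the integrand equals `Re Φ + ‖k - k 0‖^2` with `Φ`
-- analytic in the whole disk. The mean value property evaluates the first term, and the second is
-- nonnegative.
open Complex MeasureTheory ComplexConjugate in
theorem le_integral_circle_normSq {k : ℂ → ℂ} (hk : DifferentiableOn ℂ k (ball 0 1)) {t : ℝ}
    (ht0 : 0 < t) (ht1 : t < 1) :
    2 * Real.pi * ((t ^ 4)⁻¹ + ‖k 0‖ ^ 2) ≤
      ∫ θ in (-Real.pi)..Real.pi, ‖-1 / circleMap 0 t θ ^ 2 + k (circleMap 0 t θ)‖ ^ 2 := by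
  have hsub : closedBall (0 : ℂ) t ⊆ ball 0 1 := closedBall_subset_ball ht1
  have hkc : ContinuousOn k (sphere 0 t) := hk.continuousOn.mono (sphere_subset_closedBall.trans hsub)
  set b := k 0
  set Φ : ℂ → ℂ := fun z => (t ^ 4 : ℂ)⁻¹ - 2 * z ^ 2 * k z * (t ^ 4 : ℂ)⁻¹ + 2 * conj b * k z
    - (‖b‖ ^ 2 : ℝ) with hΦ
  have hΦd : DifferentiableOn ℂ Φ (ball 0 1) := by
    simp only [hΦ]
    fun_prop
  set N : ℂ → ℝ := fun z => ‖-1 / z ^ 2 + k z‖ ^ 2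
  have hNc : ContinuousOn N (sphere 0 t) := by
    refine ((ContinuousOn.add (continuousOn_const.div (by fun_prop) ?_) hkc).norm).pow 2
    intro z hz
    have : ‖z‖ = t := by simpa using hz
    have hz0 : z ≠ 0 := by rintro rfl; simp at this; linarith
    exact pow_ne_zero 2 hz0
  have havg : Real.circleAverage (fun z => (Φ z).re) 0 t = (t ^ 4)⁻¹ + ‖b‖ ^ 2 := by
    have h1 : Real.circleAverage Φ 0 t = Φ 0 := by
      apply DiffContOnCl.circleAverage
      rw [abs_of_pos ht0]
      exact hΦd.diffContOnCl_ball hsub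
    have h2 := Complex.reCLM.circleAverage_comp_comm (f := Φ) (c := 0) (R := t)
      ((hΦd.continuousOn.mono (sphere_subset_closedBall.trans hsub)).circleIntegrable ht0.le)
    have h3 : (fun z => (Φ z).re) = (⇑Complex.reCLM ∘ Φ) := rfl
    rw [h3, h2, h1]
    have h4 : Φ 0 = (((t ^ 4)⁻¹ + ‖b‖ ^ 2 : ℝ) : ℂ) := by
      simp only [hΦ]
      have := Complex.conj_mul' b
      push_cast
      linear_combination 2 * this
    rw [h4]; rfl
  have hle : Real.circleAverage (fun z => (Φ z).re) 0 t ≤ Real.circleAverage N 0 t := by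
    apply Real.circleAverage_mono
    · exact (Complex.continuous_re.comp_continuousOn
        (hΦd.continuousOn.mono (sphere_subset_closedBall.trans hsub))).circleIntegrable ht0.le
    · exact hNc.circleIntegrable ht0.le
    · intro z hz
      rw [abs_of_pos ht0] at hz
      have hzt : ‖z‖ = t := by simpa using hz
      have hz0 : z ≠ 0 := by rintro rfl; simp at hzt; linarith
      have hzz : z * conj z = (t : ℂ) ^ 2 := by rw [Complex.mul_conj', hzt]
      have ht0' : (t : ℂ) ≠ 0 := by exact_mod_cast ht0.ne'
      have hbk : 0 ≤ ‖k z - b‖ ^ 2 := by positivity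
      suffices h : N z = (Φ z).re + ‖k z - b‖ ^ 2 by
        change (Φ z).re ≤ N z
        linarith
      have hcz : conj z = (t : ℂ) ^ 2 / z := by rw [eq_div_iff hz0, mul_comm, hzz]
      have e1 : (N z : ℂ) = (Φ z + conj (Φ z)) / 2 + ((‖k z - b‖ ^ 2 : ℝ) : ℂ) := by
        simp only [N, hΦ]
        push_cast
        rw [← Complex.conj_mul', ← Complex.conj_mul', ← Complex.conj_mul']
        simp only [map_add, map_sub, map_mul, map_div₀, map_neg, map_one, map_pow, map_inv₀,
          Complex.conj_conj, Complex.conj_ofReal, hcz, map_ofNat]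
        field_simp
        ring
      apply Complex.ofReal_injective
      rw [e1, Complex.add_conj]
      push_cast
      ring
  rw [havg, Real.circleAverage_def, smul_eq_mul] at hle
  have hper : ∫ θ in (-Real.pi)..Real.pi, N (circleMap 0 t θ) =
      ∫ θ in 0..2 * Real.pi, N (circleMap 0 t θ) := by
    have hp : Function.Periodic (fun θ => N (circleMap 0 t θ)) (2 * Real.pi) :=
      fun θ => by simp only [periodic_circleMap 0 t θ]
    have := hp.intervalIntegral_add_eq (-Real.pi) 0
    rw [show -Real.pi + 2 * Real.pi = Real.pi by ring, zero_add] at this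
    exact this
  change _ ≤ ∫ θ in (-Real.pi)..Real.pi, N (circleMap 0 t θ)
  rw [hper]
  have hpi := Real.pi_pos
  rw [inv_mul_eq_div, le_div_iff₀ (by positivity)] at hle
  linarith

-- With `k = κ + z κ'` the integrand is the squared modulus of the derivative of `1 / z + z κ z`, so
-- this bounds the area of the image of the annulus from below. It is the circle estimate integrated
-- against `t dt`.
open Complex MeasureTheory in
theorem le_lintegral_annulus_normSq {k : ℂ → ℂ} (hk : DifferentiableOn ℂ k (ball 0 1)) {ρ r : ℝ}
    (hρ : 0 < ρ) (hρr : ρ < r) (hr : r < 1) :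
    ENNReal.ofReal (Real.pi * ((ρ ^ 2)⁻¹ - (r ^ 2)⁻¹ + ‖k 0‖ ^ 2 * (r ^ 2 - ρ ^ 2))) ≤
      ∫⁻ z in {z : ℂ | ρ < ‖z‖ ∧ ‖z‖ < r}, ENNReal.ofReal (‖-1 / z ^ 2 + k z‖ ^ 2) := by
  set A : Set ℂ := {z : ℂ | ρ < ‖z‖ ∧ ‖z‖ < r}
  have hAo : IsOpen A :=
    (isOpen_lt continuous_const continuous_norm).inter (isOpen_lt continuous_norm continuous_const)
  have hA1 : A ⊆ ball 0 1 := fun z hz => by simpa using hz.2.trans hr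
  have hA0 : ∀ z ∈ A, z ≠ 0 := by
    rintro z hz rfl
    have := hz.1
    simp at this
    linarith
  set q : ℂ → ℝ := fun z => ‖-1 / z ^ 2 + k z‖ ^ 2
  have hq : ContinuousOn q A := by
    refine ((ContinuousOn.add (continuousOn_const.div (by fun_prop) ?_)
      (hk.continuousOn.mono hA1)).norm).pow 2
    exact fun z hz => pow_ne_zero 2 (hA0 z hz)
  set F : ℂ → ENNReal := A.indicator fun z => ENNReal.ofReal (q z)
  have hF : Measurable F := by
    classical
    have : F = A.piecewise (fun z => ENNReal.ofReal (q z)) (fun _ => 0) := by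
      exact Set.piecewise_eq_indicator.symm
    rw [this]
    exact ContinuousOn.measurable_piecewise (ENNReal.continuous_ofReal.comp_continuousOn hq)
      continuousOn_const hAo.measurableSet
  rw [← lintegral_indicator hAo.measurableSet]
  change _ ≤ ∫⁻ z, F z
  rw [← Complex.lintegral_comp_polarCoord_symm, polarCoord_target, Measure.volume_eq_prod,
    ← Measure.prod_restrict, lintegral_prod _ ?_]
  swap
  · apply Measurable.aemeasurable
    simp only [smul_eq_mul, Complex.polarCoord_symm_apply]
    refine (ENNReal.measurable_ofReal.comp measurable_fst).mul (hF.comp ?_)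
    exact Continuous.measurable (by fun_prop)
  have hint : ENNReal.ofReal (Real.pi * ((ρ ^ 2)⁻¹ - (r ^ 2)⁻¹ + ‖k 0‖ ^ 2 * (r ^ 2 - ρ ^ 2))) =
      ∫⁻ t in Ioo ρ r, ENNReal.ofReal (t * (2 * Real.pi * ((t ^ 4)⁻¹ + ‖k 0‖ ^ 2))) := by
    have hc : ContinuousOn (fun t : ℝ => t * (2 * Real.pi * ((t ^ 4)⁻¹ + ‖k 0‖ ^ 2))) (Icc ρ r) := by
      refine continuousOn_id.mul (continuousOn_const.mul (ContinuousOn.add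
        (ContinuousOn.inv₀ (by fun_prop) ?_) continuousOn_const))
      intro t ht
      exact pow_ne_zero 4 (hρ.trans_le ht.1).ne'
    rw [← ofReal_integral_eq_lintegral_ofReal, ← integral_Ioc_eq_integral_Ioo,
      ← intervalIntegral.integral_of_le hρr.le]
    · congr 1
      have hF : ∀ t ∈ uIcc ρ r, HasDerivAt (fun t : ℝ => Real.pi * (-(t ^ 2)⁻¹ + ‖k 0‖ ^ 2 * t ^ 2))
          (t * (2 * Real.pi * ((t ^ 4)⁻¹ + ‖k 0‖ ^ 2))) t := by
        intro t ht
        rw [uIcc_of_le hρr.le] at ht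
        have ht0 : t ≠ 0 := (hρ.trans_le ht.1).ne'
        have h1 : HasDerivAt (fun t : ℝ => t ^ 2) (2 * t) t := by simpa using hasDerivAt_pow 2 t
        have h2 := (((h1.fun_inv (pow_ne_zero 2 ht0)).fun_neg.fun_add
          (h1.const_mul (‖k 0‖ ^ 2))).const_mul Real.pi)
        refine h2.congr_deriv ?_
        field_simp
      rw [intervalIntegral.integral_eq_sub_of_hasDerivAt hF]
      · ring
      · exact ContinuousOn.intervalIntegrable (by rwa [uIcc_of_le hρr.le])
    · exact (hc.integrableOn_Icc).mono_set Ioo_subset_Icc_self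
    · refine (ae_restrict_mem measurableSet_Ioo).mono fun t ht => ?_
      have : 0 < t := hρ.trans ht.1
      have := Real.pi_pos
      simp only [Pi.zero_apply]
      positivity
  rw [hint]
  refine le_trans ?_ (lintegral_mono_set (s := Ioo ρ r) fun t ht => hρ.trans ht.1)
  refine setLIntegral_mono' measurableSet_Ioo fun t ht => ?_
  have ht0 : 0 < t := hρ.trans ht.1
  have hpc : ∀ θ : ℝ, Complex.polarCoord.symm (t, θ) = circleMap 0 t θ := by
    intro θ
    rw [Complex.polarCoord_symm_apply, circleMap, Complex.exp_mul_I]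
    push_cast
    ring
  have hmem : ∀ θ : ℝ, circleMap 0 t θ ∈ A := by
    intro θ
    simp only [A, mem_ofPred_eq, norm_circleMap_zero, abs_of_pos ht0]
    exact ht
  have hqc : Continuous fun θ : ℝ => q (circleMap 0 t θ) :=
    hq.comp_continuous (continuous_circleMap 0 t) hmem
  simp only [smul_eq_mul, hpc, F, indicator_of_mem (hmem _)]
  rw [lintegral_const_mul' _ _ ENNReal.ofReal_ne_top, ENNReal.ofReal_mul ht0.le]
  gcongr
  rw [← ofReal_integral_eq_lintegral_ofReal, ← integral_Ioc_eq_integral_Ioo,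
      ← intervalIntegral.integral_of_le (by linarith [Real.pi_pos])]
  · exact ENNReal.ofReal_le_ofReal (le_integral_circle_normSq hk ht0 (ht.2.trans hr))
  · exact (hqc.integrableOn_Icc).mono_set Ioo_subset_Icc_self
  · exact Filter.Eventually.of_forall fun θ => by simp only [Pi.zero_apply, q]; positivity

open Complex ComplexConjugate in
theorem isPreconnected_setOf_lt_norm {a : ℝ} (ha : 0 < a) : IsPreconnected {u : ℂ | a < ‖u‖} := by
  have h : {u : ℂ | a < ‖u‖} = exp '' {z : ℂ | Real.log a < z.re} := by
    ext u
    constructor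
    · intro hu
      have hu0 : u ≠ 0 := norm_pos_iff.1 (ha.trans hu)
      refine ⟨log u, ?_, exp_log hu0⟩
      rw [mem_ofPred_eq, log_re]
      exact Real.log_lt_log ha hu
    · rintro ⟨z, hz, rfl⟩
      rw [mem_ofPred_eq, norm_exp]
      exact (Real.log_lt_iff_lt_exp ha).1 hz
  rw [h]
  exact ((convex_halfSpace_re_gt _).isPreconnected).image _ continuous_exp.continuousOn

open Complex ComplexConjugate in
/-- The real linear map `u ↦ u + c * conj u`. -/
noncomputable def addConj (c : ℂ) : ℂ →L[ℝ] ℂ :=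
  ContinuousLinearMap.id ℝ ℂ + c • (conjCLE : ℂ →L[ℝ] ℂ)

open Complex ComplexConjugate in
theorem addConj_apply (c u : ℂ) : addConj c u = u + c * conj u := rfl

open Complex ComplexConjugate in
theorem det_addConj (c : ℂ) : LinearMap.det (addConj c : ℂ →ₗ[ℝ] ℂ) = 1 - ‖c‖ ^ 2 := by
  rw [← LinearMap.det_toMatrix basisOneI, Matrix.det_fin_two, ← normSq_eq_norm_sq, normSq_apply]
  simp [LinearMap.toMatrix_apply, addConj_apply]
  ring

theorem half_norm_le_norm_addConj {c : ℂ} (hc : ‖c‖ ≤ 1 / 2) (u : ℂ) :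
    ‖u‖ / 2 ≤ ‖addConj c u‖ := by
  rw [addConj_apply]
  have h1 := norm_sub_le_norm_add u (c * (starRingEnd ℂ) u)
  rw [norm_mul, Complex.norm_conj] at h1
  nlinarith [norm_nonneg u]

theorem norm_addConj_le {c : ℂ} (hc : ‖c‖ ≤ 1 / 2) (u : ℂ) :
    ‖addConj c u‖ ≤ 2 * ‖u‖ := by
  rw [addConj_apply]
  have h1 := norm_add_le u (c * (starRingEnd ℂ) u)
  rw [norm_mul, Complex.norm_conj] at h1
  nlinarith [norm_nonneg u]

open ComplexConjugate in
theorem addConj_surjective {c : ℂ} (hc : ‖c‖ ≤ 1 / 2) : Function.Surjective (addConj c) := by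
  intro w
  have h1 := Complex.conj_mul' c
  have h2 : (1 - (‖c‖ : ℂ) ^ 2) ≠ 0 := by
    have : (1 - ‖c‖ ^ 2 : ℝ) ≠ 0 := by nlinarith [norm_nonneg c]
    exact_mod_cast this
  refine ⟨(w - c * conj w) / (1 - (‖c‖ : ℂ) ^ 2), ?_⟩
  rw [addConj_apply]
  simp only [map_div₀, map_sub, map_mul, map_one, map_pow, Complex.conj_ofReal, Complex.conj_conj]
  field_simp
  linear_combination -w * h1

open Complex ComplexConjugate Filter Topology in
/-- A function `1 / z + z * κ z` univalent near the pole covers the exterior of the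
ellipse-like image of a slightly enlarged disk. -/
theorem exists_eq_addConj_of_lt_norm {κ : ℂ → ℂ} (hκ : DifferentiableOn ℂ κ (ball 0 1))
    (hinj : InjOn (fun z => 1 / z + z * κ z) (ball 0 1 \ {0})) {B C ρ : ℝ}
    (hB : ∀ z ∈ closedBall (0 : ℂ) (1 / 2), ‖κ z‖ ≤ B)
    (hC : ∀ z ∈ closedBall (0 : ℂ) (1 / 2), ‖κ z - κ 0‖ ≤ C * ‖z‖) (hC0 : 0 ≤ C)
    (hρ0 : 0 < ρ) (hρ : ρ ≤ 1 / 2) (hbρ : ‖κ 0‖ * ρ ^ 2 ≤ 1 / 2)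
    {u : ℂ} (hu : 1 / ρ + 2 * C * ρ ^ 2 < ‖u‖) :
    ∃ z, z ≠ 0 ∧ ‖z‖ < ρ ∧ 1 / z + z * κ z = addConj (κ 0 * ρ ^ 2) u := by
  set a := 1 / ρ + 2 * C * ρ ^ 2 with ha
  have ha0 : 0 < a := by positivity
  set G : ℂ → ℂ := fun z => 1 / z + z * κ z
  -- On `‖z‖ = ρ`, with `u = 1 / z`, one has `z = ρ^2 * conj u`, so `1 / z + κ 0 * z` is exactly
  -- `addConj c u`: the model image of the circle is an ellipse. A round disk of radius `1 / ρ + ‖κ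
  -- 0‖ ρ` would leave an area error that does not vanish with `ρ`.
  set c : ℂ := κ 0 * ρ ^ 2 with hc
  have hcn : ‖c‖ ≤ 1 / 2 := by
    rw [hc, norm_mul, norm_pow, norm_real, Real.norm_of_nonneg hρ0.le]
    exact hbρ
  have hB0 : 0 ≤ B := (norm_nonneg _).trans (hB 0 (by simp))
  have hsub : closedBall (0 : ℂ) ρ ⊆ ball 0 1 := closedBall_subset_ball (by linarith)
  have hopen1 : IsOpen (ball (0 : ℂ) 1 \ {0}) := isOpen_ball.sdiff isClosed_singleton
  have hopen : IsOpen (ball (0 : ℂ) ρ \ {0}) := isOpen_ball.sdiff isClosed_singleton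
  have hGd : DifferentiableOn ℂ G (ball 0 1 \ {0}) := by
    refine DifferentiableOn.add (DifferentiableOn.div (by fun_prop) differentiableOn_id
      fun z hz => hz.2) (differentiableOn_id.mul (hκ.mono sdiff_subset))
  set V : Set ℂ := addConj c ⁻¹' (G '' (ball 0 ρ \ {0})) with hV
  have hVo : IsOpen V :=
    (isOpen_image_of_injOn hopen1 hGd hinj hopen
      (sdiff_subset_sdiff_left (ball_subset_closedBall.trans hsub))).preimage (addConj c).continuous
  -- Clearing the denominator extends the equation to the compact disk, so `K` is closed as a
  -- projection along a compact factor; `z = 0` contributes nothing, since it would give `1 = 0`.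
  set K : Set ℂ := {u | ∃ z ∈ closedBall (0 : ℂ) ρ, 1 + z ^ 2 * κ z = z * addConj c u} with hK
  have hVK : V ⊆ K := by
    rintro v ⟨z, ⟨hz, hz0⟩, hzv⟩
    refine ⟨z, ball_subset_closedBall hz, ?_⟩
    rw [← hzv]
    have : z ≠ 0 := hz0
    simp only [G]
    field_simp
  have hKc : IsClosed K := by
    have hcl : IsClosed {p : closedBall (0 : ℂ) ρ × ℂ |
        1 + (p.1 : ℂ) ^ 2 * κ p.1 = p.1 * addConj c p.2} := by
      have hκc : Continuous fun z : closedBall (0 : ℂ) ρ => κ z :=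
        (hκ.continuousOn.mono hsub).comp_continuous continuous_subtype_val fun z => z.2
      refine isClosed_eq ?_ (by fun_prop)
      exact continuous_const.add
        (((continuous_subtype_val.comp continuous_fst).pow 2).mul (hκc.comp continuous_fst))
    have : CompactSpace (closedBall (0 : ℂ) ρ) :=
      isCompact_iff_compactSpace.1 (isCompact_closedBall 0 ρ)
    convert isClosedMap_snd_of_compactSpace _ hcl
    ext v
    simp [hK]
  have hKX : K ∩ {u | a < ‖u‖} ⊆ V := by
    rintro v ⟨⟨z, hz, hzv⟩, hv⟩
    have hz0 : z ≠ 0 := by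
      rintro rfl
      simp at hzv
    have hGz : G z = addConj c v := by
      simp only [G]
      field_simp
      linear_combination hzv
    refine ⟨z, ⟨?_, hz0⟩, hGz⟩
    by_contra hzρ
    have hzn : ‖z‖ = ρ := le_antisymm (by simpa using hz) (by simpa using hzρ)
    have hzz : z * conj z = (ρ : ℂ) ^ 2 := by rw [Complex.mul_conj', hzn]
    have hcz0 : conj z ≠ 0 := by simpa using hz0
    -- A solution on the boundary circle differs from the ellipse model only by this term of order
    -- `ρ^2`, which forces `‖v‖ ≤ a`.
    have h1 : addConj c (v - 1 / z) = z * (κ z - κ 0) := by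
      rw [map_sub, ← hGz, addConj_apply, hc, ← hzz]
      simp only [G, map_div₀, map_one]
      field_simp
      ring
    have h2 := half_norm_le_norm_addConj hcn (v - 1 / z)
    have h3 := hC z (by rw [mem_closedBall_zero_iff, hzn]; exact hρ)
    rw [h1, norm_mul, hzn] at h2
    rw [hzn] at h3
    have h4 : ‖v - 1 / z‖ ≤ 2 * C * ρ ^ 2 := by nlinarith
    have h5 : ‖v‖ ≤ ‖v - 1 / z‖ + ‖1 / z‖ := by simpa using norm_add_le (v - 1 / z) (1 / z)
    rw [norm_div, norm_one, hzn] at h5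
    rw [mem_ofPred_eq, ha] at hv
    linarith
  have hne : ({u : ℂ | a < ‖u‖} ∩ V).Nonempty := by
    -- So close to the pole, `‖G s‖ ≥ 1 / s - B > 2 * a`; `addConj c` at most doubles norms, so the
    -- preimage has norm above `a`.
    set s : ℝ := min (ρ / 2) (1 / (2 * a + B + 1)) with hs
    have hs0 : 0 < s := by positivity
    have hsρ : s < ρ := (min_le_left _ _).trans_lt (by linarith)
    have hs1 : 2 * a + B + 1 ≤ 1 / s := by
      rw [le_div_iff₀ hs0, ← le_div_iff₀' (by positivity)]
      exact min_le_right _ _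
    have hsn : ‖(s : ℂ)‖ = s := by rw [norm_real, Real.norm_of_nonneg hs0.le]
    obtain ⟨v, hv⟩ := addConj_surjective hcn (G s)
    refine ⟨v, ?_, s, ⟨by simpa [abs_of_pos hs0] using hsρ, by
      simpa using hs0.ne'⟩, hv.symm⟩
    have h1 := norm_addConj_le hcn v
    rw [hv] at h1
    have h2 : ‖1 / (s : ℂ)‖ - ‖s * κ s‖ ≤ ‖G s‖ := norm_sub_le_norm_add _ _
    have h3 := hB s (by rw [mem_closedBall_zero_iff, hsn]; linarith)
    rw [norm_div, norm_mul, norm_one, hsn] at h2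
    have h4 : s * ‖κ s‖ ≤ B := by nlinarith [norm_nonneg (κ s)]
    rw [mem_ofPred_eq]
    linarith
  -- In the connected exterior, `V` is open, nonempty and relatively closed.
  have hcover : {u : ℂ | a < ‖u‖} ⊆ V :=
    (isPreconnected_setOf_lt_norm ha0).subset_of_closure_inter_subset hVo hne
      ((inter_subset_inter_left _ (closure_minimal hVK hKc)).trans hKX)
  obtain ⟨z, ⟨hz, hz0⟩, hzu⟩ := hcover hu
  exact ⟨z, hz0, by simpa using hz, hzu⟩

open Complex MeasureTheory in
theorem det_toSpanSingleton_restrictScalars (w : ℂ) :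
    (((ContinuousLinearMap.toSpanSingleton ℂ w).restrictScalars ℝ).det) = ‖w‖ ^ 2 := by
  simp [ContinuousLinearMap.det, LinearMap.det_restrictScalars,
    Algebra.norm_complex_eq, Complex.normSq_eq_norm_sq]

open Complex MeasureTheory in
theorem lintegral_norm_deriv_sq_eq_volume_image {f f' : ℂ → ℂ} {s : Set ℂ} (hs : MeasurableSet s)
    (hf : ∀ z ∈ s, HasDerivAt f (f' z) z) (hinj : InjOn f s) :
    ∫⁻ z in s, ENNReal.ofReal (‖f' z‖ ^ 2) = volume (f '' s) := by
  rw [← lintegral_abs_det_fderiv_eq_addHaar_image volume hs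
    (f' := fun z => (ContinuousLinearMap.toSpanSingleton ℂ (f' z)).restrictScalars ℝ)
    (fun z hz => ((hf z hz).hasFDerivAt.restrictScalars ℝ).hasFDerivWithinAt) hinj]
  simp [det_toSpanSingleton_restrictScalars]

open Complex MeasureTheory Filter Topology in
/-- The **area theorem** of Gronwall. -/
theorem norm_le_one_of_injOn_inv_add {κ : ℂ → ℂ} (hκ : DifferentiableOn ℂ κ (ball 0 1))
    (hinj : InjOn (fun z => 1 / z + z * κ z) (ball 0 1 \ {0})) : ‖κ 0‖ ≤ 1 := by
  have hhalf : closedBall (0 : ℂ) (1 / 2) ⊆ ball 0 1 := closedBall_subset_ball (by norm_num)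
  obtain ⟨B, hB⟩ := (isCompact_closedBall (0 : ℂ) (1 / 2)).exists_bound_of_continuousOn
    (hκ.continuousOn.mono hhalf)
  obtain ⟨C, hC⟩ := (isCompact_closedBall (0 : ℂ) (1 / 2)).exists_bound_of_continuousOn
    (((Complex.differentiableOn_dslope (ball_mem_nhds 0 one_pos)).2 hκ).continuousOn.mono hhalf)
  have hC0 : 0 ≤ C := (norm_nonneg _).trans (hC 0 (by simp))
  have hC' : ∀ z ∈ closedBall (0 : ℂ) (1 / 2), ‖κ z - κ 0‖ ≤ C * ‖z‖ := by
    intro z hz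
    have h := sub_smul_dslope κ 0 z
    rw [sub_zero, smul_eq_mul] at h
    rw [← h, norm_mul, mul_comm]
    exact mul_le_mul_of_nonneg_right (hC z hz) (norm_nonneg z)
  set k : ℂ → ℂ := fun z => κ z + z * deriv κ z with hk
  have hkd : DifferentiableOn ℂ k (ball 0 1) :=
    hκ.add (differentiableOn_id.mul (hκ.deriv isOpen_ball))
  have hk0 : k 0 = κ 0 := by simp [hk]
  have hev : ∀ᶠ ρ : ℝ in 𝓝[>] 0, ρ ≤ 1 / 2 ∧ ‖κ 0‖ * ρ ^ 2 ≤ 1 / 2 := by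
    apply nhdsWithin_le_nhds
    have h1 : Tendsto (fun ρ : ℝ => ρ) (𝓝 0) (𝓝 0) := tendsto_id
    have h2 : Tendsto (fun ρ : ℝ => ‖κ 0‖ * ρ ^ 2) (𝓝 0) (𝓝 0) := by
      have : Continuous (fun ρ : ℝ => ‖κ 0‖ * ρ ^ 2) := by fun_prop
      simpa using this.tendsto 0
    filter_upwards [h1.eventually_le_const (u := 1 / 2) (by norm_num),
      h2.eventually_le_const (u := 1 / 2) (by norm_num)] with ρ a b using ⟨a, b⟩
  have hmain : ∀ r ∈ Ioo (0 : ℝ) 1, ∀ᶠ ρ : ℝ in 𝓝[>] 0,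
      ‖κ 0‖ ^ 2 * (r ^ 2 - ρ ^ 2) ≤ (r ^ 2)⁻¹ + 4 * C * ρ + 4 * C ^ 2 * ρ ^ 4 := by
    intro r hr
    have hρr : ∀ᶠ ρ : ℝ in 𝓝[>] 0, ρ < r := nhdsWithin_le_nhds (eventually_lt_nhds hr.1)
    filter_upwards [hev, hρr, self_mem_nhdsWithin] with ρ ⟨hρ, hbρ⟩ hρr hρ0
    replace hρ0 : 0 < ρ := hρ0
    set A : Set ℂ := {z : ℂ | ρ < ‖z‖ ∧ ‖z‖ < r}
    have hAo : IsOpen A := (isOpen_lt continuous_const continuous_norm).inter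
      (isOpen_lt continuous_norm continuous_const)
    have hA : A ⊆ ball 0 1 \ {0} := by
      rintro z ⟨hz1, hz2⟩
      refine ⟨by simpa using hz2.trans hr.2, ?_⟩
      rintro rfl
      simp at hz1
      linarith
    set c : ℂ := κ 0 * ρ ^ 2 with hc
    have hcn : ‖c‖ ≤ 1 / 2 := by
      rw [hc, norm_mul, norm_pow, norm_real, Real.norm_of_nonneg hρ0.le]
      exact hbρ
    -- Values outside the ellipse are already taken at points with `‖z‖ < ρ`, so univalence keeps
    -- the annulus from taking them again.
    have himg : (fun z => 1 / z + z * κ z) '' A ⊆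
        addConj c '' closedBall 0 (1 / ρ + 2 * C * ρ ^ 2) := by
      rintro _ ⟨z, hz, rfl⟩
      obtain ⟨u, hu⟩ := addConj_surjective hcn (1 / z + z * κ z)
      refine ⟨u, ?_, hu⟩
      rw [mem_closedBall_zero_iff]
      by_contra! hlt
      obtain ⟨z', hz'0, hz'ρ, hz'⟩ :=
        exists_eq_addConj_of_lt_norm hκ hinj hB hC' hC0 hρ0 hρ hbρ hlt
      have : z' = z := hinj ⟨by simpa using hz'ρ.trans (by linarith), hz'0⟩ (hA hz) (hz'.trans hu)
      rw [this] at hz'ρ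
      exact hz'ρ.not_gt hz.1
    have h1 := le_lintegral_annulus_normSq hkd hρ0 hρr hr.2
    rw [lintegral_norm_deriv_sq_eq_volume_image (f := fun z => 1 / z + z * κ z) hAo.measurableSet
      ?_ (hinj.mono hA)] at h1
    · have h2 := h1.trans (measure_mono himg)
      rw [Measure.addHaar_image_continuousLinearMap, det_addConj, Complex.volume_closedBall,
        ← ENNReal.ofReal_pow (by positivity), ← ENNReal.ofReal_coe_nnreal, NNReal.coe_real_pi,
        ← ENNReal.ofReal_mul (by positivity), ← ENNReal.ofReal_mul (abs_nonneg _),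
        ENNReal.ofReal_le_ofReal_iff (by positivity), hk0] at h2
      have habs : |1 - ‖c‖ ^ 2| ≤ 1 := by
        rw [abs_le]
        constructor <;> nlinarith [norm_nonneg c]
      have h3 := h2.trans (mul_le_of_le_one_left (by positivity) habs)
      rw [mul_comm _ Real.pi] at h3
      have h4 := le_of_mul_le_mul_left h3 Real.pi_pos
      -- The divergent `(ρ ^ 2)⁻¹` cancels against the lower bound for the area, and the other two
      -- terms vanish as `ρ → 0`.
      have h5 : (1 / ρ + 2 * C * ρ ^ 2) ^ 2 = (ρ ^ 2)⁻¹ + 4 * C * ρ + 4 * C ^ 2 * ρ ^ 4 := by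
        field_simp
        ring
      linarith
    · intro z hz
      have hz0 : z ≠ 0 := (hA hz).2
      have h3 := (hasDerivAt_inv hz0).add ((hasDerivAt_id z).mul
        (hκ.differentiableAt (isOpen_ball.mem_nhds (hA hz).1)).hasDerivAt)
      convert! h3 using 1
      · ext w
        simp
      · simp only [hk, id]
        field_simp
  have hlim : ∀ r ∈ Ioo (0 : ℝ) 1, ‖κ 0‖ ^ 2 * r ^ 2 ≤ (r ^ 2)⁻¹ := by
    intro r hr
    have h1 : Tendsto (fun ρ : ℝ => ‖κ 0‖ ^ 2 * (r ^ 2 - ρ ^ 2)) (𝓝[>] 0)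
        (𝓝 (‖κ 0‖ ^ 2 * r ^ 2)) := by
      have : Continuous (fun ρ : ℝ => ‖κ 0‖ ^ 2 * (r ^ 2 - ρ ^ 2)) := by fun_prop
      simpa using (this.tendsto 0).mono_left nhdsWithin_le_nhds
    have h2 : Tendsto (fun ρ : ℝ => (r ^ 2)⁻¹ + 4 * C * ρ + 4 * C ^ 2 * ρ ^ 4) (𝓝[>] 0)
        (𝓝 (r ^ 2)⁻¹) := by
      have : Continuous (fun ρ : ℝ => (r ^ 2)⁻¹ + 4 * C * ρ + 4 * C ^ 2 * ρ ^ 4) := by fun_prop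
      simpa using (this.tendsto 0).mono_left nhdsWithin_le_nhds
    exact le_of_tendsto_of_tendsto h1 h2 (hmain r hr)
  have h1 : Tendsto (fun r : ℝ => ‖κ 0‖ ^ 2 * r ^ 2) (𝓝[<] 1) (𝓝 (‖κ 0‖ ^ 2)) := by
    have : Continuous (fun r : ℝ => ‖κ 0‖ ^ 2 * r ^ 2) := by fun_prop
    simpa using (this.tendsto 1).mono_left nhdsWithin_le_nhds
  have h2 : Tendsto (fun r : ℝ => (r ^ 2)⁻¹) (𝓝[<] 1) (𝓝 1) := by
    have : ContinuousAt (fun r : ℝ => (r ^ 2)⁻¹) 1 :=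
      ContinuousAt.inv₀ (by fun_prop) (by norm_num)
    simpa using this.tendsto.mono_left nhdsWithin_le_nhds
  have h3 : ‖κ 0‖ ^ 2 ≤ 1 := le_of_tendsto_of_tendsto h1 h2 (by
    filter_upwards [Ioo_mem_nhdsLT (zero_lt_one (α := ℝ))] with r hr using hlim r hr)
  exact (sq_le_one_iff₀ (norm_nonneg _)).1 h3

/-! ### Bieberbach's inequality. -/

open Complex Filter Topology in
/-- **Bieberbach's inequality** for the second coefficient of a univalent function. -/
theorem norm_deriv_deriv_zero_le {h : ℂ → ℂ} (hd : DifferentiableOn ℂ h (ball 0 1))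
    (hinj : InjOn h (ball 0 1)) : ‖deriv (deriv h) 0‖ ≤ 4 * ‖deriv h 0‖ := by
  have h0mem : (0 : ℂ) ∈ ball (0 : ℂ) 1 := mem_ball_self one_pos
  have hnhds : ball (0 : ℂ) 1 ∈ 𝓝 (0 : ℂ) := ball_mem_nhds 0 one_pos
  have hne : deriv h 0 ≠ 0 := deriv_ne_zero_of_injOn isOpen_ball hd hinj h0mem
  set H : ℂ → ℂ := fun v => dslope h 0 v / deriv h 0 with hH
  have hHd : DifferentiableOn ℂ H (ball 0 1) :=
    ((differentiableOn_dslope hnhds).2 hd).div_const _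
  have hhH : ∀ v, h v = h 0 + v * (deriv h 0 * H v) := by
    intro v
    have h1 := sub_smul_dslope h 0 v
    rw [sub_zero, smul_eq_mul] at h1
    simp only [hH]
    field_simp
    linear_combination -h1
  have hH0 : H 0 = 1 := by simp [hH, hne]
  have hHne : ∀ v ∈ ball (0 : ℂ) 1, H v ≠ 0 := by
    intro v hv hHv
    have h1 := hhH v
    rw [hHv, mul_zero, mul_zero, add_zero] at h1
    rw [hinj hv h0mem h1, hH0] at hHv
    exact one_ne_zero hHv
  obtain ⟨l, hld, hl⟩ := exists_differentiableOn_exp_eq isOpen_ball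
    (isSimplyConnected_ball 0 one_pos) hHd hHne
  -- `M` is the branch of `H^(-1/2)` with `M 0 = 1`. Then `M (z^2) / z` is the reciprocal of an odd
  -- square root of `(h (z^2) - h 0) / h' 0`, to which the area theorem applies.
  set M : ℂ → ℂ := fun v => exp (-(l v - l 0) / 2) with hM
  have hMd : DifferentiableOn ℂ M (ball 0 1) := by
    simp only [hM]
    fun_prop
  have hM0 : M 0 = 1 := by simp [hM]
  have hMH : ∀ v ∈ ball (0 : ℂ) 1, M v ^ 2 * H v = 1 := by
    intro v hv
    rw [← hl v hv, hM, ← exp_nat_mul, ← exp_add, ← hH0, ← hl 0 h0mem]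
    congr 1
    push_cast
    ring
  have hsq : ∀ z ∈ ball (0 : ℂ) 1, z ^ 2 ∈ ball (0 : ℂ) 1 := by
    intro z hz
    rw [mem_ball_zero_iff] at hz ⊢
    rw [norm_pow]
    exact pow_lt_one₀ (norm_nonneg z) hz two_ne_zero
  have hκd : DifferentiableOn ℂ (fun z => dslope M 0 (z ^ 2)) (ball 0 1) :=
    ((differentiableOn_dslope hnhds).2 hMd).fun_comp (by fun_prop) hsq
  have hG : ∀ z : ℂ, z ≠ 0 → 1 / z + z * dslope M 0 (z ^ 2) = M (z ^ 2) / z := by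
    intro z hz
    have h1 := sub_smul_dslope M 0 (z ^ 2)
    rw [sub_zero, smul_eq_mul, hM0] at h1
    field_simp
    linear_combination h1
  have hκ := norm_le_one_of_injOn_inv_add hκd (by
    rintro z ⟨hz, hz0⟩ w ⟨hw, hw0⟩ hzw
    replace hz0 : z ≠ 0 := hz0
    replace hw0 : w ≠ 0 := hw0
    simp only [hG z hz0, hG w hw0] at hzw
    -- Equal values of `M (x^2) / x` thus give equal `h (x^2)`, hence equal squares; oddness then
    -- excludes opposite points.
    have key : ∀ x ∈ ball (0 : ℂ) 1, x ≠ 0 →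
        (M (x ^ 2) / x) ^ 2 * (h (x ^ 2) - h 0) = deriv h 0 := by
      intro x hx hx0
      have h1 := hMH _ (hsq x hx)
      rw [hhH (x ^ 2), add_sub_cancel_left, div_pow, div_mul_eq_mul_div, div_eq_iff (pow_ne_zero 2 hx0)]
      linear_combination (deriv h 0 * x ^ 2) * h1
    have hMne : M (z ^ 2) ≠ 0 := exp_ne_zero _
    have h1 : (M (z ^ 2) / z) ^ 2 * (h (z ^ 2) - h 0) =
        (M (z ^ 2) / z) ^ 2 * (h (w ^ 2) - h 0) := by
      rw [key z hz hz0, hzw, key w hw hw0]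
    have h2 := mul_left_cancel₀ (pow_ne_zero 2 (div_ne_zero hMne hz0)) h1
    have h3 : z ^ 2 = w ^ 2 := hinj (hsq z hz) (hsq w hw) (sub_left_injective h2)
    rw [← h3] at hzw
    field_simp at hzw
    exact hzw.symm)
  have hl0 : HasDerivAt l (deriv l 0) 0 := (hld.differentiableAt hnhds).hasDerivAt
  have hM' : deriv M 0 = -deriv l 0 / 2 := by
    have h1 := (((hl0.sub_const (l 0)).fun_neg).div_const 2).cexp
    rw [hM, h1.deriv]
    simp
  have hH' : deriv H 0 = deriv l 0 := by
    have h1 : HasDerivAt H (exp (l 0) * deriv l 0) 0 := hl0.cexp.congr_of_eventuallyEq (by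
      filter_upwards [hnhds] with v hv using (hl v hv).symm)
    rw [h1.deriv, hl 0 h0mem, hH0, one_mul]
  have hh' : deriv h =ᶠ[𝓝 0] fun v => deriv h 0 * (H v + v * deriv H v) := by
    filter_upwards [hnhds] with v hv
    have h1 := (((hasDerivAt_id v).mul (((hHd.differentiableAt
      (isOpen_ball.mem_nhds hv)).hasDerivAt).const_mul (deriv h 0))).const_add (h 0))
    have h2 : h = fun v => h 0 + ((id : ℂ → ℂ) * fun v => deriv h 0 * H v) v := funext hhH
    have h3 := h1.deriv
    rw [← h2] at h3
    rw [h3]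
    simp only [id]
    ring
  have hh'' : deriv (deriv h) 0 = deriv h 0 * (2 * deriv H 0) := by
    rw [hh'.deriv_eq]
    have h1 := (((hHd.differentiableAt hnhds).hasDerivAt.add ((hasDerivAt_id (0 : ℂ)).mul
      (((hHd.deriv isOpen_ball).differentiableAt hnhds).hasDerivAt))).const_mul (deriv h 0)).deriv
    simp only [id, zero_mul, add_zero, one_mul] at h1
    rw [two_mul, ← h1]
    rfl
  have hM1 : ‖deriv M 0‖ ≤ 1 := by simpa using hκ
  -- From `h'' 0 = 2 * h' 0 * H' 0` and `M' 0 = -H' 0 / 2`.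
  have : deriv (deriv h) 0 = -4 * (deriv h 0 * deriv M 0) := by
    rw [hh'', hM', hH']
    ring
  rw [this, norm_mul, norm_mul, norm_neg]
  norm_num
  nlinarith [norm_nonneg (deriv h 0)]

/-! ### Limits of analytic functions: Hurwitz and Montel. -/

open Filter Topology in
/-- **Hurwitz's theorem**: a zero of the limit of zero-free analytic functions is not isolated. -/
theorem eventually_eq_zero_of_tendstoLocallyUniformlyOn {ι : Type*} {φ : Filter ι} [φ.NeBot]
    {F : ι → ℂ → ℂ} {f : ℂ → ℂ} {U : Set ℂ} (hU : IsOpen U)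
    (hlim : TendstoLocallyUniformlyOn F f φ U) (hF : ∀ n, DifferentiableOn ℂ (F n) U)
    (h0 : ∀ n, ∀ z ∈ U, F n z ≠ 0) {a : ℂ} (ha : a ∈ U) (hfa : f a = 0) :
    ∀ᶠ z in 𝓝 a, f z = 0 := by
  have hfd : DifferentiableOn ℂ f U := hlim.differentiableOn (Eventually.of_forall hF) hU
  refine (hfd.analyticAt (hU.mem_nhds ha)).eventually_eq_zero_or_eventually_ne_zero.resolve_right ?_
  intro hne
  rw [eventually_nhdsWithin_iff] at hne
  obtain ⟨r, hr, hball⟩ := (nhds_basis_closedBall.mem_iff).1 (inter_mem hne (hU.mem_nhds ha))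
  have hballU : closedBall a r ⊆ U := fun z hz => (hball hz).2
  obtain ⟨w, hw, hmin⟩ := (isCompact_sphere a r).exists_isMinOn (NormedSpace.sphere_nonempty.2 hr.le)
    ((hfd.continuousOn.mono (sphere_subset_closedBall.trans hballU)).norm)
  have hwa : w ≠ a := ne_of_mem_sphere hw hr.ne'
  have hε : 0 < ‖f w‖ := norm_pos_iff.2 ((hball (sphere_subset_closedBall hw)).1 hwa)
  set ε := ‖f w‖
  have hunif := (tendstoLocallyUniformlyOn_iff_forall_isCompact hU).1 hlim _ hballU
    (isCompact_closedBall a r)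
  obtain ⟨n, hn⟩ := (Metric.tendstoUniformlyOn_iff.1 hunif (ε / 2) (by positivity)).exists
  have hsphere : ∀ z ∈ sphere a r, ε / 2 ≤ ‖F n z‖ := by
    intro z hz
    have h1 := hn z (sphere_subset_closedBall hz)
    have h2 : ε ≤ ‖f z‖ := hmin hz
    rw [dist_eq_norm] at h1
    have h3 := norm_sub_norm_le (f z) (F n z)
    linarith
  have hca : ‖F n a‖ < ε / 2 := by
    have h1 := hn a (mem_closedBall_self hr.le)
    rwa [hfa, dist_zero_left] at h1
  -- The maximum principle for `1 / F n` contradicts `F n` being smaller at the centre than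
  -- everywhere on the circle.
  have hinv : DifferentiableOn ℂ (fun z => (F n z)⁻¹) U := (hF n).inv (h0 n)
  have hmax := Complex.norm_le_of_forall_mem_frontier_norm_le isBounded_ball
    (hinv.diffContOnCl_ball hballU) (C := (ε / 2)⁻¹) (fun z hz => by
      rw [frontier_ball a hr.ne'] at hz
      rw [norm_inv]
      exact inv_anti₀ (by positivity) (hsphere z hz)) (subset_closure (mem_ball_self hr))
  rw [norm_inv] at hmax
  have hpos : 0 < ‖F n a‖ := norm_pos_iff.2 (h0 n a ha)
  exact hca.not_ge ((inv_le_inv₀ hpos (by positivity)).1 hmax)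

-- If `f a = f b`, Hurwitz's theorem for `F n - F n b` on `U \ {b}` makes `f` constant near `a`,
-- hence on all of `U`, against the nonzero derivative.
open Filter Topology in
theorem injOn_of_tendstoLocallyUniformlyOn {ι : Type*} {φ : Filter ι} [φ.NeBot]
    {F : ι → ℂ → ℂ} {f : ℂ → ℂ} {U : Set ℂ} (hU : IsOpen U) (hUc : IsPreconnected U)
    (hlim : TendstoLocallyUniformlyOn F f φ U) (hF : ∀ n, DifferentiableOn ℂ (F n) U)
    (hinj : ∀ n, InjOn (F n) U) {z₀ : ℂ} (hz₀ : z₀ ∈ U) (hf : deriv f z₀ ≠ 0) : InjOn f U := by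
  have hfd : DifferentiableOn ℂ f U := hlim.differentiableOn (Eventually.of_forall hF) hU
  intro a ha b hb hab
  by_contra hne
  have hV : IsOpen (U \ {b}) := hU.sdiff isClosed_singleton
  have hlim' : TendstoLocallyUniformlyOn (fun n z => F n z - F n b) (fun z => f z - f b) φ
      (U \ {b}) := by
    have hb' : TendstoLocallyUniformlyOn (fun n (_ : ℂ) => F n b) (fun _ => f b) φ (U \ {b}) := by
      rw [Metric.tendstoLocallyUniformlyOn_iff]
      intro ε hε x _
      refine ⟨univ, univ_mem, ?_⟩
      filter_upwards [Metric.tendsto_nhds.1 (hlim.tendsto_at hb) ε hε] with n hn y _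
      rwa [dist_comm]
    exact (hlim.mono sdiff_subset).fun_sub hb'
  have h1 := eventually_eq_zero_of_tendstoLocallyUniformlyOn hV hlim'
    (fun n => ((hF n).mono sdiff_subset).sub_const _)
    (fun n z hz h => hz.2 (hinj n hz.1 hb (sub_eq_zero.1 h))) (a := a) ⟨ha, hne⟩
    (sub_eq_zero.2 hab)
  have h2 : EqOn f (fun _ => f b) U :=
    (hfd.analyticOnNhd hU).eqOn_of_preconnected_of_eventuallyEq analyticOnNhd_const hUc ha
      (h1.mono fun z hz => sub_eq_zero.1 hz)
  apply hf
  have h3 : f =ᶠ[𝓝 z₀] fun _ => f b := by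
    filter_upwards [hU.mem_nhds hz₀] with z hz using h2 hz
  rw [h3.deriv_eq, deriv_const]

open Filter Topology in
/-- A form of **Montel's theorem**: a sequence of analytic maps into the unit disk converges locally
uniformly along an ultrafilter. -/
theorem exists_tendstoLocallyUniformlyOn_hyperfilter {F : ℕ → ℂ → ℂ} {U : Set ℂ} (hU : IsOpen U)
    (hF : ∀ n, DifferentiableOn ℂ (F n) U) (hm : ∀ n, MapsTo (F n) U (ball 0 1)) :
    ∃ f : ℂ → ℂ, TendstoLocallyUniformlyOn F f (hyperfilter ℕ) U ∧
      MapsTo f U (closedBall 0 1) := by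
  have hex : ∀ z, ∃ w, z ∈ U → w ∈ closedBall (0 : ℂ) 1 ∧
      Tendsto (fun n => F n z) (hyperfilter ℕ) (𝓝 w) := by
    intro z
    by_cases hz : z ∈ U
    · obtain ⟨w, hw, hlim⟩ := (isCompact_closedBall (0 : ℂ) 1).ultrafilter_le_nhds
        ((hyperfilter ℕ).map fun n => F n z) (by
          rw [Ultrafilter.coe_map, le_principal_iff]
          exact mem_map.2 (univ_mem' fun n => ball_subset_closedBall (hm n hz)))
      exact ⟨w, fun _ => ⟨hw, hlim⟩⟩
    · exact ⟨0, fun h => absurd h hz⟩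
  choose f hf using hex
  refine ⟨f, ?_, fun z hz => (hf z hz).1⟩
  rw [Metric.tendstoLocallyUniformlyOn_iff]
  intro ε hε x hx
  obtain ⟨R, hR, hRU⟩ := Metric.isOpen_iff.1 hU x hx
  -- The Schwarz lemma gives a Lipschitz bound independent of `n`, which turns the pointwise
  -- ultrafilter limits into locally uniform ones.
  have hlip : ∀ n, ∀ y ∈ ball x R, dist (F n y) (F n x) ≤ 2 / R * dist y x := by
    intro n y hy
    refine Complex.dist_le_div_mul_dist_of_mapsTo_ball ((hF n).mono hRU) (fun w hw => ?_) hy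
    have h1 := hm n (hRU hw)
    have h2 := hm n hx
    rw [mem_ball_zero_iff] at h1 h2
    rw [mem_closedBall, dist_eq_norm]
    linarith [norm_sub_le (F n w) (F n x)]
  have hlipf : ∀ y ∈ ball x R, dist (f y) (f x) ≤ 2 / R * dist y x := fun y hy =>
    le_of_tendsto ((hf y (hRU hy)).2.dist (hf x hx).2) (Eventually.of_forall fun n => hlip n y hy)
  refine ⟨ball x (min R (ε * R / 6)), nhdsWithin_le_nhds (ball_mem_nhds _ (by positivity)), ?_⟩
  filter_upwards [Metric.tendsto_nhds.1 (hf x hx).2 (ε / 3) (by positivity)] with n hn y hy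
  rw [mem_ball, lt_min_iff] at hy
  have h1 := hlipf y hy.1
  have h2 := hlip n y hy.1
  have h3 : 2 / R * dist y x < ε / 3 := by
    rw [div_mul_eq_mul_div, div_lt_iff₀ hR]
    linarith [hy.2]
  have h4 := dist_triangle4 (f y) (f x) (F n x) (F n y)
  rw [dist_comm (f x), dist_comm (F n x) (F n y)] at h4
  linarith

/-! ### The Riemann mapping theorem. -/

/-- The automorphism `z ↦ (z - a) / (1 - conj a * z)` of the unit disk. -/
noncomputable def diskMap (a z : ℂ) : ℂ := (z - a) / (1 - (starRingEnd ℂ) a * z)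

theorem one_sub_conj_mul_ne_zero {a z : ℂ} (ha : a ∈ ball (0 : ℂ) 1) (hz : z ∈ ball (0 : ℂ) 1) :
    1 - (starRingEnd ℂ) a * z ≠ 0 := by
  intro h
  rw [mem_ball_zero_iff] at ha hz
  have h1 : ‖(starRingEnd ℂ) a * z‖ = 1 := by rw [← sub_eq_zero.1 h, norm_one]
  rw [norm_mul, Complex.norm_conj] at h1
  nlinarith [norm_nonneg a, norm_nonneg z]

theorem mapsTo_diskMap {a : ℂ} (ha : a ∈ ball (0 : ℂ) 1) :
    MapsTo (diskMap a) (ball 0 1) (ball 0 1) := by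
  intro z hz
  have hne := one_sub_conj_mul_ne_zero ha hz
  rw [mem_ball_zero_iff] at ha hz ⊢
  rw [diskMap, norm_div, div_lt_one (norm_pos_iff.2 hne), ← sq_lt_sq₀ (norm_nonneg _) (norm_nonneg _)]
  have h1 : ‖1 - (starRingEnd ℂ) a * z‖ ^ 2 - ‖z - a‖ ^ 2 = (1 - ‖a‖ ^ 2) * (1 - ‖z‖ ^ 2) := by
    simp only [← Complex.normSq_eq_norm_sq, Complex.normSq_apply, Complex.sub_re, Complex.sub_im,
      Complex.mul_re, Complex.mul_im, Complex.one_re, Complex.one_im, Complex.conj_re,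
      Complex.conj_im]
    ring
  have h2 : 0 < 1 - ‖a‖ ^ 2 := by nlinarith [norm_nonneg a]
  have h3 : 0 < 1 - ‖z‖ ^ 2 := by nlinarith [norm_nonneg z]
  nlinarith [mul_pos h2 h3]

theorem hasDerivAt_diskMap {a z : ℂ} (ha : a ∈ ball (0 : ℂ) 1) (hz : z ∈ ball (0 : ℂ) 1) :
    HasDerivAt (diskMap a) ((1 - ‖a‖ ^ 2) / (1 - (starRingEnd ℂ) a * z) ^ 2) z := by
  have h := ((hasDerivAt_id z).sub_const a).fun_div
    (((hasDerivAt_id z).const_mul ((starRingEnd ℂ) a)).const_sub 1) (one_sub_conj_mul_ne_zero ha hz)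
  refine h.congr_deriv ?_
  have := Complex.conj_mul' a
  congr 1
  simp only [id]
  linear_combination -this

theorem differentiableOn_diskMap {a : ℂ} (ha : a ∈ ball (0 : ℂ) 1) :
    DifferentiableOn ℂ (diskMap a) (ball 0 1) := fun _ hz =>
  (hasDerivAt_diskMap ha hz).differentiableAt.differentiableWithinAt

theorem one_sub_norm_sq_ne_zero {a : ℂ} (ha : a ∈ ball (0 : ℂ) 1) : (1 - (‖a‖ : ℂ) ^ 2) ≠ 0 := by
  rw [mem_ball_zero_iff] at ha
  have : (1 - ‖a‖ ^ 2 : ℝ) ≠ 0 := by nlinarith [norm_nonneg a]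
  exact_mod_cast this

theorem injOn_diskMap {a : ℂ} (ha : a ∈ ball (0 : ℂ) 1) : InjOn (diskMap a) (ball 0 1) := by
  intro z hz w hw h
  have hz' := one_sub_conj_mul_ne_zero ha hz
  have hw' := one_sub_conj_mul_ne_zero ha hw
  rw [diskMap, diskMap, div_eq_div_iff hz' hw'] at h
  have h1 := Complex.conj_mul' a
  have h2 : (1 - (‖a‖ : ℂ) ^ 2) * (z - w) = 0 := by
    linear_combination h + (z - w) * h1
  exact sub_eq_zero.1 ((mul_eq_zero.1 h2).resolve_left (one_sub_norm_sq_ne_zero ha))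

/-- The analytic univalent maps of `U` into the unit disk. -/
def univalentDiskMaps (U : Set ℂ) : Set (ℂ → ℂ) :=
  {f | DifferentiableOn ℂ f U ∧ MapsTo f U (ball 0 1) ∧ InjOn f U}

theorem diskMap_comp_mem {U : Set ℂ} {f : ℂ → ℂ} (hf : f ∈ univalentDiskMaps U) {a : ℂ}
    (ha : a ∈ ball (0 : ℂ) 1) : (fun z => diskMap a (f z)) ∈ univalentDiskMaps U :=
  ⟨(differentiableOn_diskMap ha).fun_comp hf.1 hf.2.1, (mapsTo_diskMap ha).comp hf.2.1,
    (injOn_diskMap ha).comp hf.2.2 hf.2.1⟩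

theorem deriv_diskMap_comp {U : Set ℂ} (hU : IsOpen U) {f : ℂ → ℂ}
    (hf : f ∈ univalentDiskMaps U) {a : ℂ} (ha : a ∈ ball (0 : ℂ) 1) {z : ℂ} (hz : z ∈ U) :
    deriv (fun z => diskMap a (f z)) z =
      (1 - ‖a‖ ^ 2) / (1 - (starRingEnd ℂ) a * f z) ^ 2 * deriv f z :=
  ((hasDerivAt_diskMap ha (hf.2.1 hz)).comp z
    (hf.1.differentiableAt (hU.mem_nhds hz)).hasDerivAt).deriv

-- A maximising sequence has a locally uniform limit. Its derivative at `z₀` is at least that of a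
-- univalent competitor, so it is nonzero and the limit is univalent by Hurwitz; its open image in
-- the closed disk avoids the boundary.
open Filter Topology in
theorem exists_isMaxOn_norm_deriv {U : Set ℂ} (hU : IsOpen U) (hUc : IsPreconnected U)
    (hne : (univalentDiskMaps U).Nonempty) {z₀ : ℂ} (hz₀ : z₀ ∈ U) :
    ∃ f ∈ univalentDiskMaps U, ∀ g ∈ univalentDiskMaps U, ‖deriv g z₀‖ ≤ ‖deriv f z₀‖ := by
  set S : Set ℝ := (fun g => ‖deriv g z₀‖) '' univalentDiskMaps U with hS
  obtain ⟨R, hR, hRU⟩ := Metric.isOpen_iff.1 hU z₀ hz₀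
  have hbdd : BddAbove S := by
    refine ⟨2 / R, ?_⟩
    rintro _ ⟨g, hg, rfl⟩
    refine Complex.norm_deriv_le_div_of_mapsTo_ball (hg.1.mono hRU) (fun w hw => ?_) hR
    have h1 := hg.2.1 (hRU hw)
    have h2 := hg.2.1 hz₀
    rw [mem_ball_zero_iff] at h1 h2
    rw [mem_closedBall, dist_eq_norm]
    linarith [norm_sub_le (g w) (g z₀)]
  obtain ⟨u, -, hu, huS⟩ := exists_seq_tendsto_sSup (hne.image _) hbdd
  choose F hF hFu using huS
  obtain ⟨f, hlim, hfm⟩ := exists_tendstoLocallyUniformlyOn_hyperfilter hU (fun n => (hF n).1)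
    (fun n => (hF n).2.1)
  have hfd : DifferentiableOn ℂ f U :=
    hlim.differentiableOn (Eventually.of_forall fun n => (hF n).1) hU
  have h1 : Tendsto (fun n => ‖deriv (F n) z₀‖) (hyperfilter ℕ) (𝓝 ‖deriv f z₀‖) :=
    ((hlim.deriv (Eventually.of_forall fun n => (hF n).1) hU).tendsto_at hz₀).norm
  have h2 : Tendsto (fun n => ‖deriv (F n) z₀‖) (hyperfilter ℕ) (𝓝 (sSup S)) := by
    have : (fun n => ‖deriv (F n) z₀‖) = u := funext hFu
    rw [this]
    exact hu.mono_left Nat.hyperfilter_le_atTop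
  have hmax : ‖deriv f z₀‖ = sSup S := tendsto_nhds_unique h1 h2
  have hle : ∀ g ∈ univalentDiskMaps U, ‖deriv g z₀‖ ≤ ‖deriv f z₀‖ := fun g hg => by
    rw [hmax]
    exact le_csSup hbdd (mem_image_of_mem _ hg)
  obtain ⟨g, hg⟩ := hne
  have hf0 : deriv f z₀ ≠ 0 :=
    norm_pos_iff.1 ((norm_pos_iff.2 (deriv_ne_zero_of_injOn hU hg.1 hg.2.2 hz₀)).trans_le (hle g hg))
  have hinj := injOn_of_tendstoLocallyUniformlyOn hU hUc hlim (fun n => (hF n).1)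
    (fun n => (hF n).2.2) hz₀ hf0
  refine ⟨f, ⟨hfd, fun z hz => ?_, hinj⟩, hle⟩
  have h3 := interior_maximal hfm.image_subset (isOpen_image_of_injOn hU hfd hinj hU Subset.rfl)
  rw [interior_closedBall _ one_ne_zero] at h3
  exact h3 (mem_image_of_mem f hz)

open Complex in
/-- The square-root step of the Riemann mapping theorem: an omitted value of a normalised map of `U`
into the disk allows one to enlarge the derivative. -/
theorem exists_norm_deriv_lt {U : Set ℂ} (hU : IsOpen U) (hsc : IsSimplyConnected U)
    {f : ℂ → ℂ} (hf : f ∈ univalentDiskMaps U) {z₀ : ℂ} (hz₀ : z₀ ∈ U) (hfz : f z₀ = 0) {w : ℂ}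
    (hw : w ∈ ball (0 : ℂ) 1) (hwf : ∀ z ∈ U, f z ≠ w) :
    ∃ g ∈ univalentDiskMaps U, ‖deriv f z₀‖ < ‖deriv g z₀‖ := by
  have hw0 : w ≠ 0 := fun h => hwf z₀ hz₀ (hfz.trans h.symm)
  have hh := diskMap_comp_mem hf hw
  have hh0 : ∀ z ∈ U, diskMap w (f z) ≠ 0 := fun z hz =>
    div_ne_zero (sub_ne_zero.2 (hwf z hz)) (one_sub_conj_mul_ne_zero hw (hf.2.1 hz))
  obtain ⟨l, hld, hl⟩ := exists_differentiableOn_exp_eq hU hsc hh.1 hh0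
  set q : ℂ → ℂ := fun z => exp (l z / 2) with hq
  have hqsq : ∀ z ∈ U, q z ^ 2 = diskMap w (f z) := by
    intro z hz
    rw [← hl z hz, hq, ← exp_nat_mul]
    congr 1
    push_cast
    ring
  have hqF : q ∈ univalentDiskMaps U := by
    refine ⟨(hld.div_const 2).cexp, fun z hz => ?_, fun z hz y hy hzy => ?_⟩
    · have h1 := hh.2.1 hz
      simp only [← hqsq z hz, mem_ball_zero_iff, norm_pow] at h1
      rw [mem_ball_zero_iff]
      exact (pow_lt_one_iff_of_nonneg (norm_nonneg _) two_ne_zero).1 h1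
    · apply hh.2.2 hz hy
      simp only [← hqsq z hz, ← hqsq y hy, hzy]
  have hb := hqF.2.1 hz₀
  refine ⟨_, diskMap_comp_mem hqF hb, ?_⟩
  rw [deriv_diskMap_comp hU hqF hb hz₀]
  have hqd := (hqF.1.differentiableAt (hU.mem_nhds hz₀)).hasDerivAt
  have hdq : 2 * q z₀ * deriv q z₀ = (1 - ‖w‖ ^ 2) * deriv f z₀ := by
    have h1 : HasDerivAt (fun z => diskMap w (f z)) (2 * q z₀ * deriv q z₀) z₀ := by
      have h2 := hqd.fun_pow 2
      simp only [Nat.cast_ofNat, Nat.add_one_sub_one, pow_one] at h2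
      refine h2.congr_of_eventuallyEq ?_
      filter_upwards [hU.mem_nhds hz₀] with z hz using (hqsq z hz).symm
    rw [← h1.deriv, deriv_diskMap_comp hU hf hw hz₀, hfz]
    simp
  have hqn : ‖q z₀‖ ^ 2 = ‖w‖ := by
    rw [← norm_pow, hqsq z₀ hz₀, diskMap, hfz]
    simp
  have hd0 : 0 < ‖deriv f z₀‖ := norm_pos_iff.2 (deriv_ne_zero_of_injOn hU hf.1 hf.2.2 hz₀)
  have hb1 : ‖q z₀‖ < 1 := by simpa using hb
  have hb0 : 0 < ‖q z₀‖ := norm_pos_iff.2 (exp_ne_zero _)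
  set s := ‖q z₀‖ with hs
  have hs2 : 0 < 1 - s ^ 2 := by nlinarith
  have hn1 : ‖(1 - (s : ℂ) ^ 2)‖ = 1 - s ^ 2 := by
    have : (1 - (s : ℂ) ^ 2) = ((1 - s ^ 2 : ℝ) : ℂ) := by push_cast; rfl
    rw [this, norm_real, Real.norm_of_nonneg hs2.le]
  have hn2 : ‖(1 - (‖w‖ : ℂ) ^ 2)‖ = 1 - s ^ 4 := by
    have : (1 - (‖w‖ : ℂ) ^ 2) = ((1 - s ^ 4 : ℝ) : ℂ) := by rw [← hqn]; push_cast; ring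
    rw [this, norm_real, Real.norm_of_nonneg (by nlinarith)]
  have hdqn : 2 * s * ‖deriv q z₀‖ = (1 - s ^ 4) * ‖deriv f z₀‖ := by
    have := congrArg norm hdq
    rw [norm_mul, norm_mul, norm_mul, hn2] at this
    simpa using this
  rw [conj_mul', ← hs, norm_mul, norm_div, norm_pow, hn1]
  -- Here `s^2 = ‖w‖`. Taking the square root and recentring multiplies the derivative by `(1 + s^2)
  -- / (2 * s)`, which exceeds 1 because `(1 - s)^2 > 0`.
  have h3 : (1 - s ^ 2) / (1 - s ^ 2) ^ 2 * ‖deriv q z₀‖ =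
      (1 + s ^ 2) / (2 * s) * ‖deriv f z₀‖ := by
    rw [div_mul_eq_mul_div, div_mul_eq_mul_div, div_eq_div_iff (by positivity) (by positivity)]
    linear_combination (1 - s ^ 2) * hdqn
  rw [h3]
  have h4 : 1 < (1 + s ^ 2) / (2 * s) := by
    rw [one_lt_div (by positivity)]
    nlinarith [sq_pos_of_pos (sub_pos.2 hb1)]
  nlinarith

-- A square root `q` of `z - a` is univalent and never takes both a value and its negative. Its
-- image contains a disk about `q z₀`, so it omits the opposite disk, and an inversion there makes
-- it bounded.
open Complex in
theorem univalentDiskMaps_nonempty {U : Set ℂ} (hU : IsOpen U) (hsc : IsSimplyConnected U)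
    (hne : U ≠ univ) : (univalentDiskMaps U).Nonempty := by
  obtain ⟨a, ha⟩ := (ne_univ_iff_exists_notMem U).1 hne
  obtain ⟨z₀, hz₀⟩ := hsc.nonempty
  have hza : ∀ z ∈ U, z - a ≠ 0 := fun z hz h => ha (sub_eq_zero.1 h ▸ hz)
  obtain ⟨l, hld, hl⟩ := exists_differentiableOn_exp_eq hU hsc
    (F := fun z => z - a) (by fun_prop) hza
  set q : ℂ → ℂ := fun z => exp (l z / 2) with hq
  have hqsq : ∀ z ∈ U, q z ^ 2 = z - a := by
    intro z hz
    rw [← hl z hz, hq, ← exp_nat_mul]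
    congr 1
    push_cast
    ring
  have hqd : DifferentiableOn ℂ q U := (hld.div_const 2).cexp
  have hqi : InjOn q U := by
    intro z hz w hw h
    have h1 := hqsq z hz
    rw [h, hqsq w hw] at h1
    exact (sub_left_injective h1).symm
  obtain ⟨ε, hε, hball⟩ := Metric.isOpen_iff.1 (isOpen_image_of_injOn hU hqd hqi hU Subset.rfl)
    (q z₀) (mem_image_of_mem q hz₀)
  have hdist : ∀ z ∈ U, ε ≤ ‖q z + q z₀‖ := by
    intro z hz
    by_contra! hlt
    obtain ⟨y, hy, hyz⟩ := hball (show -q z ∈ ball (q z₀) ε by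
      rw [mem_ball, dist_eq_norm, ← norm_neg]
      simpa [add_comm] using hlt)
    have h1 := hqsq y hy
    rw [hyz, neg_sq, hqsq z hz] at h1
    have h2 : z = y := sub_left_injective h1
    rw [h2] at hyz
    have h3 : q y = 0 := by linear_combination hyz / 2
    exact exp_ne_zero _ h3
  have hne0 : ∀ z ∈ U, q z + q z₀ ≠ 0 := fun z hz =>
    norm_pos_iff.1 (hε.trans_le (hdist z hz))
  have hε0 : ((ε / 2 : ℝ) : ℂ) ≠ 0 := by exact_mod_cast (half_pos hε).ne'
  refine ⟨fun z => (ε / 2 : ℝ) / (q z + q z₀),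
    (differentiableOn_const _).fun_div (hqd.add_const _) hne0, fun z hz => ?_, fun z hz w hw h => ?_⟩
  · rw [mem_ball_zero_iff, norm_div, norm_real, Real.norm_of_nonneg (by positivity),
      div_lt_one (hε.trans_le (hdist z hz))]
    linarith [hdist z hz]
  · rw [div_eq_div_iff (hne0 z hz) (hne0 w hw)] at h
    exact hqi hz hw (add_right_cancel (mul_left_cancel₀ hε0 h)).symm

/-- The **Riemann mapping theorem**. -/
theorem exists_surjOn_univalentDiskMaps {U : Set ℂ} (hU : IsOpen U) (hsc : IsSimplyConnected U)
    (hne : U ≠ univ) : ∃ f ∈ univalentDiskMaps U, f '' U = ball 0 1 := by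
  obtain ⟨z₀, hz₀⟩ := hsc.nonempty
  obtain ⟨f, hf, hmax⟩ := exists_isMaxOn_norm_deriv hU hsc.isPathConnected.isConnected.isPreconnected
    (univalentDiskMaps_nonempty hU hsc hne) hz₀
  have ha := hf.2.1 hz₀
  have hg := diskMap_comp_mem hf ha
  refine ⟨_, hg, hg.2.1.image_subset.antisymm fun w hw => ?_⟩
  by_contra hwg
  obtain ⟨k, hk, hlt⟩ := exists_norm_deriv_lt hU hsc hg hz₀ (by simp [diskMap]) hw
    (fun z hz h => hwg ⟨z, hz, h⟩)
  -- Moving `f z₀` to 0 multiplies the derivative by `1 / (1 - s^2) ≥ 1`, so the normalised map does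
  -- at least as well as the extremal `f`.
  refine (hlt.trans_le (hmax k hk)).not_ge ?_
  rw [deriv_diskMap_comp hU hf ha hz₀, Complex.conj_mul', norm_mul, norm_div, norm_pow]
  rw [mem_ball_zero_iff] at ha
  set s := ‖f z₀‖
  have hs2 : 0 < 1 - s ^ 2 := by nlinarith [norm_nonneg (f z₀)]
  have hn1 : ‖(1 - (s : ℂ) ^ 2)‖ = 1 - s ^ 2 := by
    have : (1 - (s : ℂ) ^ 2) = ((1 - s ^ 2 : ℝ) : ℂ) := by push_cast; rfl
    rw [this, Complex.norm_real, Real.norm_of_nonneg hs2.le]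
  rw [hn1]
  refine le_mul_of_one_le_left (norm_nonneg _) ?_
  rw [one_le_div (by positivity)]
  nlinarith [sq_nonneg s]

/-! ### Disk coverings, the hyperbolic density and the final estimate. -/

theorem Homeomorph.isCoveringMap {X Y : Type*} [TopologicalSpace X] [TopologicalSpace Y]
    (e : X ≃ₜ Y) : IsCoveringMap e := by
  have hid : IsCoveringMap (id : X → X) := fun x => by
    refine IsEvenlyCovered.to_isEvenlyCovered_preimage (I := Unit)
      ⟨inferInstance, univ, mem_univ x, isOpen_univ, isOpen_univ, (Homeomorph.prodPUnit _).symm, ?_⟩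
    intro y
    rfl
  exact hid.homeomorph_comp e

/-- A hyperbolic simply connected region is analytically covered by the disk. -/
theorem exists_isAnalyticDiskCovering {D : Set ℂ} (hD : IsOpen D) (hsc : IsSimplyConnected D)
    (hne : D ≠ univ) : ∃ p, IsAnalyticDiskCovering p D := by
  obtain ⟨f, ⟨hfd, hfm, hfi⟩, hf⟩ := exists_surjOn_univalentDiskMaps hD hsc hne
  obtain ⟨p, hpd, hp⟩ := exists_differentiableOn_leftInvOn hD hfd hfi
  rw [hf] at hpd
  have hpm : MapsTo p (ball 0 1) D := by
    rw [← hf]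
    rintro _ ⟨z, hz, rfl⟩
    rwa [hp hz]
  have hfp : ∀ w ∈ ball (0 : ℂ) 1, f (p w) = w := by
    rw [← hf]
    rintro _ ⟨z, hz, rfl⟩
    rw [hp hz]
  refine ⟨p, hpd, hpm.image_subset.antisymm fun z hz => ⟨f z, hfm hz, hp hz⟩, ?_⟩
  refine IsCoveringMapOn.of_isCoveringMap_subtype hD (fun x => hpm x.2) ?_
  let e : ball (0 : ℂ) 1 ≃ₜ D :=
    { toFun := fun x => ⟨p x, hpm x.2⟩
      invFun := fun y => ⟨f y, hfm y.2⟩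
      left_inv := fun x => Subtype.ext (hfp x x.2)
      right_inv := fun y => Subtype.ext (hp y.2)
      continuous_toFun :=
        (hpd.continuousOn.comp_continuous continuous_subtype_val fun x => x.2).subtype_mk _
      continuous_invFun :=
        (hfd.continuousOn.comp_continuous continuous_subtype_val fun x => x.2).subtype_mk _ }
  exact e.isCoveringMap

/-- Every analytic covering of a simply connected region by the disk is univalent. -/
theorem IsAnalyticDiskCovering.injOn {p : ℂ → ℂ} {D : Set ℂ} (hp : IsAnalyticDiskCovering p D)
    (hD : IsOpen D) (hsc : IsSimplyConnected D) : InjOn p (ball 0 1) := by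
  obtain ⟨hpd, himg, hcov⟩ := hp
  have hpm : MapsTo p (ball 0 1) D := by
    rw [← himg]
    exact mapsTo_image _ _
  have := hsc.simplyConnectedSpace
  have := hD.locallyPathConnectedSpace
  have : SimplyConnectedSpace (ball (0 : ℂ) 1) :=
    (isSimplyConnected_ball 0 one_pos).simplyConnectedSpace
  have : LocallyPathConnectedSpace (ball (0 : ℂ) 1) :=
    (isOpen_ball (x := (0 : ℂ)) (ε := 1)).locallyPathConnectedSpace
  intro z₁ hz₁ z₂ hz₂ h
  -- `s` is a section of `p` over `D` with `s (p z₁) = z₁`. Both `s ∘ p` and the identity lift `p`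
  -- and agree at `z₁`, so they coincide, and `p z₁ = p z₂` gives `z₁ = z₂`.
  obtain ⟨s, ⟨hs0, hs⟩, -⟩ := hcov.existsUnique_continuousMap_lifts
    (⟨Subtype.val, continuous_subtype_val⟩ : C(D, ℂ)) (a₀ := ⟨p z₁, hpm hz₁⟩)
    (e₀ := ⟨z₁, hz₁⟩) rfl (fun y => y.2)
  let P : C(ball (0 : ℂ) 1, D) := ⟨fun x => ⟨p x, hpm x.2⟩,
    (hpd.continuousOn.comp_continuous continuous_subtype_val fun x => x.2).subtype_mk _⟩
  have huniq := (hcov.existsUnique_continuousMap_lifts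
    (⟨fun x => p x, hpd.continuousOn.comp_continuous continuous_subtype_val fun x => x.2⟩ :
      C(ball (0 : ℂ) 1, ℂ)) (a₀ := ⟨z₁, hz₁⟩) (e₀ := ⟨z₁, hz₁⟩) rfl (fun x => hpm x.2)).unique
    (y₁ := s.comp P) (y₂ := ContinuousMap.id _) ⟨hs0, by
      funext x
      exact congrFun hs (P x)⟩ ⟨rfl, rfl⟩
  have h1 := DFunLike.congr_fun huniq ⟨z₂, hz₂⟩
  have h2 : P ⟨z₂, hz₂⟩ = ⟨p z₁, hpm hz₁⟩ := Subtype.ext h.symm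
  have h3 : s (P ⟨z₂, hz₂⟩) = ⟨z₂, hz₂⟩ := h1
  rw [h2, hs0] at h3
  exact congrArg Subtype.val h3

open Complex Filter Topology in
/-- Comparison of Bieberbach's inequality for a univalent map of the disk and for its composition
with a univalent function. -/
theorem norm_deriv_deriv_div_mul_le {P f : ℂ → ℂ} {D : Set ℂ} (hD : IsOpen D)
    (hP : DifferentiableOn ℂ P (ball 0 1)) (hPi : InjOn P (ball 0 1))
    (hPm : MapsTo P (ball 0 1) D) (hf : IsConformalMapping f D) :
    ‖deriv (deriv f) (P 0) / deriv f (P 0)‖ * ‖deriv P 0‖ ≤ 8 := by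
  have h0 : (0 : ℂ) ∈ ball (0 : ℂ) 1 := mem_ball_self one_pos
  have hnhds : ball (0 : ℂ) 1 ∈ 𝓝 (0 : ℂ) := isOpen_ball.mem_nhds h0
  have hP0 : deriv P 0 ≠ 0 := deriv_ne_zero_of_injOn isOpen_ball hP hPi h0
  have hf0 : deriv f (P 0) ≠ 0 := deriv_ne_zero_of_injOn hD hf.1 hf.2 (hPm h0)
  have h1 := norm_deriv_deriv_zero_le hP hPi
  have h2 := norm_deriv_deriv_zero_le (hf.1.comp hP hPm) (hf.2.comp hPi hPm)
  have hd : ∀ x ∈ ball (0 : ℂ) 1, deriv (f ∘ P) x = deriv f (P x) * deriv P x := fun x hx =>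
    deriv_comp x (hf.1.differentiableAt (hD.mem_nhds (hPm hx)))
      (hP.differentiableAt (isOpen_ball.mem_nhds hx))
  have hdd : deriv (deriv (f ∘ P)) 0 =
      deriv (deriv f) (P 0) * deriv P 0 * deriv P 0 + deriv f (P 0) * deriv (deriv P) 0 := by
    have he : deriv (f ∘ P) =ᶠ[𝓝 0] fun x => deriv f (P x) * deriv P x := by
      filter_upwards [hnhds] with x hx using hd x hx
    rw [he.deriv_eq]
    have h3 := ((hf.1.deriv hD).differentiableAt (hD.mem_nhds (hPm h0))).hasDerivAt.comp 0
      (hP.differentiableAt hnhds).hasDerivAt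
    exact (h3.mul ((hP.deriv isOpen_ball).differentiableAt hnhds).hasDerivAt).deriv
  rw [hdd, hd 0 h0, norm_mul] at h2
  have h4 := norm_sub_le_norm_add (deriv (deriv f) (P 0) * deriv P 0 * deriv P 0)
    (deriv f (P 0) * deriv (deriv P) 0)
  rw [norm_mul, norm_mul, norm_mul] at h4
  have hPn := norm_pos_iff.2 hP0
  have hfn := norm_pos_iff.2 hf0
  rw [norm_div, div_mul_eq_mul_div, div_le_iff₀ hfn]
  refine le_of_mul_le_mul_right ?_ hPn
  -- Each use of Bieberbach's inequality contributes `4 * ‖f'‖ * ‖P'‖`.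
  have h5 := mul_le_mul_of_nonneg_left h1 hfn.le
  linarith

/-- On a simply connected region the hyperbolic density at `w` is `1 / ‖P' 0‖` for a univalent map
`P` of the disk onto the region with `P 0 = w`. -/
theorem exists_hyperbolicDensity_mul_eq_one {D : Set ℂ} (hD : IsOpen D) (hsc : IsSimplyConnected D)
    (hne : D ≠ univ) {w : ℂ} (hw : w ∈ D) :
    ∃ P : ℂ → ℂ, DifferentiableOn ℂ P (ball 0 1) ∧ InjOn P (ball 0 1) ∧ MapsTo P (ball 0 1) D ∧
      P 0 = w ∧ hyperbolicDensity D w * ‖deriv P 0‖ = 1 := by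
  have hex : ∃ r, IsHyperbolicDensityAt D w r := by
    obtain ⟨p, hp⟩ := exists_isAnalyticDiskCovering hD hsc hne
    obtain ⟨z, hz, hzw⟩ := hp.2.1.symm.subset hw
    have hpn := norm_ne_zero_iff.2
      (deriv_ne_zero_of_injOn isOpen_ball hp.1 (hp.injOn hD hsc) hz)
    exact ⟨1 / (1 - ‖z‖ ^ 2) / ‖deriv p z‖, p, hp, z, hz, hzw, div_mul_cancel₀ _ hpn⟩
  -- The chosen value comes with its own covering `p` and preimage `z`, so uniqueness of the density
  -- is not needed. Precomposing `p` with the automorphism sending 0 to `z` turns the derivative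
  -- into `p' z * (1 - ‖z‖^2)`, matching the defining relation.
  obtain ⟨p, hp, z, hz, hzw, hr⟩ := hex.choose_spec
  have hdens : hyperbolicDensity D w = hex.choose := dif_pos hex
  rw [← hdens] at hr
  have hpm : MapsTo p (ball 0 1) D := mapsTo_iff_image_subset.2 hp.2.1.subset
  have h0 : (0 : ℂ) ∈ ball (0 : ℂ) 1 := mem_ball_self one_pos
  have hz' : -z ∈ ball (0 : ℂ) 1 := by simpa using hz
  have hm0 : diskMap (-z) 0 = z := by simp [diskMap]
  have hmaps := mapsTo_diskMap hz'
  refine ⟨p ∘ diskMap (-z), hp.1.comp (differentiableOn_diskMap hz') hmaps,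
    (hp.injOn hD hsc).comp (injOn_diskMap hz') hmaps, hpm.comp hmaps, by simp [hm0, hzw], ?_⟩
  have hder : HasDerivAt p (deriv p z) (diskMap (-z) 0) := by
    rw [hm0]
    exact (hp.1.differentiableAt (isOpen_ball.mem_nhds hz)).hasDerivAt
  have h1 := (hder.comp 0 (hasDerivAt_diskMap hz' h0)).deriv
  rw [mem_ball_zero_iff] at hz
  have hpos : 0 < 1 - ‖z‖ ^ 2 := by nlinarith [norm_nonneg z]
  rw [mul_zero, sub_zero, one_pow, div_one, norm_neg] at h1
  have hcast : (1 - (‖z‖ : ℂ) ^ 2) = ((1 - ‖z‖ ^ 2 : ℝ) : ℂ) := by push_cast; rfl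
  rw [h1, hcast, norm_mul, Complex.norm_real, Real.norm_of_nonneg hpos.le, ← mul_assoc, hr,
    one_div_mul_cancel hpos.ne']

theorem theorem2p4 (D : Set ℂ) (hD : IsHyperbolicRegion D) (hsc : IsSimplyConnected D)
    (f : ℂ → ℂ) (hf : IsConformalMapping f D) :
    ∃ g : ℂ → ℂ, DifferentiableOn ℂ g D ∧
      (∀ z ∈ D, Complex.exp (g z) = deriv f z) ∧
      (∀ z ∈ D, deriv g z = deriv (deriv f) z / deriv f z) ∧
      ∀ z ∈ D, ‖deriv g z‖ ≤ 8 * hyperbolicDensity D z := by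
  obtain ⟨hDo, -, hDc⟩ := hD
  have hne : D ≠ univ := by
    rintro rfl
    simp at hDc
  obtain ⟨g, hgd, hg⟩ := exists_differentiableOn_exp_eq hDo hsc (hf.1.deriv hDo)
    fun z hz => deriv_ne_zero_of_injOn hDo hf.1 hf.2 hz
  have hg' : ∀ z ∈ D, deriv g z = deriv (deriv f) z / deriv f z := by
    intro z hz
    have h1 : HasDerivAt (deriv f) (Complex.exp (g z) * deriv g z) z :=
      (hgd.differentiableAt (hDo.mem_nhds hz)).hasDerivAt.cexp.congr_of_eventuallyEq (by
        filter_upwards [hDo.mem_nhds hz] with w hw using (hg w hw).symm)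
    rw [h1.deriv, ← hg z hz, mul_div_cancel_left₀ _ (Complex.exp_ne_zero _)]
  refine ⟨g, hgd, hg, hg', fun z hz => ?_⟩
  obtain ⟨P, hPd, hPi, hPm, rfl, hP⟩ := exists_hyperbolicDensity_mul_eq_one hDo hsc hne hz
  have h1 := norm_deriv_deriv_div_mul_le hDo hPd hPi hPm hf
  rw [hg' _ hz]
  have hPn : 0 < ‖deriv P 0‖ := norm_pos_iff.2 (deriv_ne_zero_of_injOn isOpen_ball hPd hPi
    (mem_ball_self one_pos))
  refine le_of_mul_le_mul_right ?_ hPn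
  rw [mul_assoc, hP]
  linarith
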